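/- Let $M=(S,s_0,A,\delta)$ be a finite Markov decision process: $S$ and $A$ are finite, every state $s$ has a non-empty set $A(s)\subseteq A$ of available actions, and $\delta(s,a)$ is a probability distribution on $S$ for every $s\in S$ and $a\in A(s)$. A strategy $\sigma\in\Sigma$ (history-dependent and randomized) assigns to every finite path a distribution on the actions available in its last state; it induces a Markov chain $M^\sigma$, whose states are the finite paths, and a probability measure $\mathbb P_M^\sigma$ on infinite paths. A state $s$ is absorbing if $\delta(s,a)(s)=1$ for all $a\in A(s)$. Write $\lozenge T$ for the event that some state in $T$ is visited. Let $\Phi=(F,r)$ be a weighted reachability objective, i.e. a set $F\subseteq S$ of target states and a reward function $r:F\to\mathbb Q$, where all targets are absorbing and $r(s)\neq 0$ for all $s\in F$. Let $\vec o=(o_1,\dots,o_k)$ be the increasing enumeration of the set of outcomes $r(F)\cup\{0\}$. For a Markov chain with states labelled by elements of $S$, the obtainset of an outcome $o\ne0$ is the set of states labelled by some $s\in F$ with $r(s)=o$, and the obtainset of $0$ is the union of all bottom strongly connected components (BSCCs) without target states. The prospect induced by the chain is $(\vec o,\vec p)$, where $p_i$ is the probability that the chain reaches the obtainset of $o_i$.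 In $M^\sigma$ a finite path is labelled by its last state, and BSCCs are read through this labelling: a state $q$ belongs to a BSCC with label set $B$ if its label is in $B$ and, from every state reachable from $q$, the labels that can be reached in at least one step are exactly those in $B$. (If the labels are the states themselves, these are the usual BSCCs.) Write $\mathrm{prospect}(M^\sigma,\Phi)$ for the prospect induced by $M^\sigma$. Let $M$ be stopping with sink $z$: $z\in S\setminus F$ is absorbing and $\mathbb P_M^\sigma[\lozenge(F\cup\{z\})]=1$ for every $\sigma\in\Sigma$. In $M$, let $\mathrm{obtainset}(o)=\{s\in F: r(s)=o\}$ for $o\neq 0$ and $\mathrm{obtainset}(0)=\{z\}$, and consider the multi-objective reachability query $\mathcal Q=(\mathrm{obtainset}(o_1),\dots,\mathrm{obtainset}(o_k))$. Let $$\mathcal A=\{\vec p\in\mathbb R^k:\exists\sigma\in\Sigma\ \forall i\ \ p_i\le \mathbb P_M^\sigma[\lozenge\,\mathrm{obtainset}(o_i)]\}$$ be its set of achievable points, and $\mathcal P=\{u\in\mathcal A:\neg\exists v\in\mathcal A,\ u\ne v\wedge u\le v\}$ (pointwise order) its Pareto frontier. Then $$\{\mathrm{prospect}(M^\sigma,\Phi):\sigma\in\Sigma\}=\{(\vec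 o,\vec p):\vec p\in\mathcal P\}.$$ -/

import Mathlib

open MeasureTheory ProbabilityTheory

noncomputable section

/-! ## Markov chains -/

/-- A Markov chain: an initial state and, for every state, a distribution over successors. -/
structure MarkovChain (Q : Type*) where
  init : Q
  trans : Q → PMF Q

namespace MarkovChain

variable {Q S : Type*}

/-- There is a transition of positive probability from `q` to `q'`. -/
def Step (C : MarkovChain Q) (q q' : Q) : Prop := q' ∈ (C.trans q).support

/-- The transition function as a Markov kernel from histories `q₀, …, qₙ` to the next state. -/
def stepKernel [MeasurableSpace Q] [DiscreteMeasurableSpace Q] (C : MarkovChain Q) (n : ℕ) :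
    Kernel ((_ : Finset.Iic n) → Q) Q where
  toFun x := (C.trans (x ⟨n, Finset.mem_Iic.2 le_rfl⟩)).toMeasure
  measurable' := (Measurable.of_discrete (f := fun q => (C.trans q).toMeasure)).comp
    (measurable_pi_apply _)

instance [MeasurableSpace Q] [DiscreteMeasurableSpace Q] (C : MarkovChain Q) (n : ℕ) :
    IsMarkovKernel (C.stepKernel n) :=
  ⟨fun x => PMF.toMeasure.isProbabilityMeasure
    (C.trans (x ⟨n, Finset.mem_Iic.2 le_rfl⟩))⟩

/-- The probability measure on infinite paths `ℕ → Q` of the chain started in its initial state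
(Ionescu-Tulcea). -/
def pathMeasure [MeasurableSpace Q] [DiscreteMeasurableSpace Q] (C : MarkovChain Q) :
    Measure (ℕ → Q) :=
  Kernel.trajMeasure (X := fun _ => Q) (Measure.dirac C.init) C.stepKernel

/-- `ℙ_C[◇ T]`: the probability that the path visits `T` at some time. -/
def reachProb [MeasurableSpace Q] [DiscreteMeasurableSpace Q] (C : MarkovChain Q)
    (T : Set Q) : ℝ :=
  C.pathMeasure.real {ω | ∃ j, ω j ∈ T}

/-- `B` is strongly connected: non-empty, with a non-empty finite path between any two (possibly
equal) of its states. -/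
def IsStronglyConnected (C : MarkovChain Q) (B : Set Q) : Prop :=
  B.Nonempty ∧ ∀ q ∈ B, ∀ q' ∈ B, Relation.TransGen C.Step q q'

/-- `B` is a bottom strongly connected component (BSCC): an inclusion-maximal strongly connected
set that cannot be left. -/
def IsBSCC (C : MarkovChain Q) (B : Set Q) : Prop :=
  Maximal C.IsStronglyConnected B ∧ ∀ q ∈ B, ∀ q', C.Step q q' → q' ∈ B

/-- BSCCs read through a labelling `lab : Q → S` of the states. `C.InBSCC lab q B` says that `q`
lies in a bottom component whose set of labels is `B`: the label of `q` belongs to `B`, and from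
every state reachable from `q`, the labels that can be seen after at least one step are exactly
those in `B`.

For `lab = id` this is the textbook notion (`inBSCC_id_iff`). The chain induced by a strategy has
the finite paths of the MDP as its states, so as a graph it is a tree; such a state stands for the
last state of the path, and BSCCs have to be read through that labelling. -/
def InBSCC (C : MarkovChain Q) (lab : Q → S) (q : Q) (B : Set S) : Prop :=
  lab q ∈ B ∧ ∀ q', Relation.ReflTransGen C.Step q q' →
    {s | ∃ q'', Relation.TransGen C.Step q' q'' ∧ lab q'' = s} = B

theorem inBSCC_id_iff (C : MarkovChain Q) (q : Q) (B : Set Q) :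
    C.InBSCC id q B ↔ C.IsBSCC B ∧ q ∈ B := by
  constructor
  · rintro ⟨hq, h⟩
    have key : ∀ q', Relation.ReflTransGen C.Step q q' →
        ∀ r, Relation.TransGen C.Step q' r ↔ r ∈ B := by
      intro q' hq' r
      rw [← h q' hq']
      simp
    have hr : ∀ r ∈ B, Relation.ReflTransGen C.Step q r := fun r hr =>
      ((key q .refl r).2 hr).to_reflTransGen
    refine ⟨⟨⟨⟨⟨q, hq⟩, fun r hrB r' hrB' => (key r (hr r hrB) r').2 hrB'⟩, ?_⟩, ?_⟩, hq⟩
    · intro D hD hBD d hd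
      exact (key q .refl d).1 (hD.2 q (hBD hq) d hd)
    · intro r hrB r' hs
      exact (key r (hr r hrB) r').1 (.single hs)
  · rintro ⟨⟨hmax, hcl⟩, hq⟩
    have hcl' : ∀ r r', Relation.ReflTransGen C.Step r r' → r ∈ B → r' ∈ B := by
      intro r r' hrr' hrB
      induction hrr' with
      | refl => exact hrB
      | tail _ hs ih => exact hcl _ ih _ hs
    refine ⟨hq, fun q' hq' => ?_⟩
    ext s
    simp only [id, exists_eq_right, Set.mem_ofPred_eq]
    exact ⟨fun hs => hcl' q' s hs.to_reflTransGen (hcl' q q' hq' hq),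
      fun hs => hmax.prop.2 q' (hcl' q q' hq' hq) s hs⟩

end MarkovChain

/-! ## Weighted reachability objectives and prospects -/

/-- A weighted reachability objective: a set of target states with a rational reward for each. -/
structure WRObjective (S : Type*) where
  target : Set S
  reward : target → ℚ

namespace WRObjective

variable {Q S : Type*}

/-- The set of outcomes: all rewards of target states, and `0`. -/
def outc (Φ : WRObjective S) : Set ℚ := {o | ∃ s, Φ.reward s = o} ∪ {0}

/-- The target states whose reward is `o`. -/
def rewardSet (Φ : WRObjective S) (o : ℚ) : Set S :=
  {s | ∃ h : s ∈ Φ.target, Φ.reward ⟨s, h⟩ = o}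

/-- The states of a Markov chain (labelled by `S`) that obtain the outcome `o`: the targets with
reward `o` if `o ≠ 0`, and the union of all BSCCs without target states if `o = 0`. -/
def chainObtainset (Φ : WRObjective S) (C : MarkovChain Q) (lab : Q → S) (o : ℚ) : Set Q :=
  open Classical in
  if o = 0 then {q | ∃ B : Set S, C.InBSCC lab q B ∧ B ∩ Φ.target = ∅}
  else {q | lab q ∈ Φ.rewardSet o}

/-- The prospect `(o, p)` induced by a Markov chain, where `o` is the vector of outcomes:
`p i` is the probability to reach the obtainset of `o i`. -/
def prospect [MeasurableSpace Q] [DiscreteMeasurableSpace Q] (Φ : WRObjective S) {k : ℕ}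
    (o : Fin k → ℚ) (C : MarkovChain Q) (lab : Q → S) : (Fin k → ℚ) × (Fin k → ℝ) :=
  (o, fun i => C.reachProb (Φ.chainObtainset C lab (o i)))

end WRObjective

/-! ## Markov decision processes -/

/-- A Markov decision process with states `S` and actions `A` (both are finite in the theorem). In
every state some action is available, and transitions are defined for available actions only. -/
structure MDP (S A : Type*) where
  init : S
  avail : S → Set A
  avail_nonempty : ∀ s, (avail s).Nonempty
  trans : (s : S) → avail s → PMF S

namespace MDP

variable {S A : Type*}

/-- The last state of the sequence `init a₀ s₁ a₁ s₂ … aₙ₋₁ sₙ`, which is stored as the list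
`[(aₙ₋₁, sₙ), …, (a₀, s₁)]` with the most recent step first. -/
def lastOf (M : MDP S A) : List (A × S) → S
  | [] => M.init
  | (_, s) :: _ => s

/-- The sequence is a path: every action is available where it is taken, and every successor has
positive probability. -/
def IsPath (M : MDP S A) : List (A × S) → Prop
  | [] => True
  | (a, s) :: h => M.IsPath h ∧
      ∃ ha : a ∈ M.avail (M.lastOf h), s ∈ (M.trans (M.lastOf h) ⟨a, ha⟩).support

/-- The finite paths of the MDP that start in its initial state. -/
def FPath (M : MDP S A) : Type _ := {h : List (A × S) // M.IsPath h}

instance (M : MDP S A) : MeasurableSpace M.FPath := ⊤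

instance (M : MDP S A) : DiscreteMeasurableSpace M.FPath := ⟨fun _ => trivial⟩

/-- The last state of a finite path. -/
def FPath.last {M : MDP S A} (h : M.FPath) : S := M.lastOf h.1

/-- The path consisting of the initial state only. -/
def FPath.start (M : MDP S A) : M.FPath := ⟨[], trivial⟩

/-- Extend a finite path by an action and a possible successor. -/
def FPath.extend {M : MDP S A} (h : M.FPath) (a : M.avail h.last) (s : S)
    (hs : s ∈ (M.trans h.last a).support) : M.FPath :=
  ⟨(a.1, s) :: h.1, h.2, a.2, hs⟩

/-- A (history-dependent, randomized) strategy: for every finite path a distribution over the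
actions available in its last state. -/
def Strategy (M : MDP S A) : Type _ := (h : M.FPath) → PMF (M.avail h.last)

/-- The Markov chain `M^σ` induced by a strategy: its states are the finite paths of `M`. An
infinite path of `M` is identified with the sequence of its finite prefixes. -/
def induced (M : MDP S A) (σ : M.Strategy) : MarkovChain M.FPath where
  init := FPath.start M
  trans h := (σ h).bind fun a =>
    (M.trans h.last a).bindOnSupport fun s hs => PMF.pure (h.extend a s hs)

/-- `ℙ_M^σ[◇ T]`: the probability that, under `σ`, a state in `T` is visited. -/
def reachProb (M : MDP S A) (σ : M.Strategy) (T : Set S) : ℝ :=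
  (M.induced σ).reachProb {h | h.last ∈ T}

/-- Every available action stays in `s` surely. -/
def IsAbsorbing (M : MDP S A) (s : S) : Prop := ∀ a, M.trans s a = PMF.pure s

/-- `M` is stopping with sink `z`: `z` is an absorbing non-target state, and under every strategy a
target or the sink is reached almost surely. -/
structure IsStopping (M : MDP S A) (Φ : WRObjective S) (z : S) : Prop where
  sink_notMem : z ∉ Φ.target
  sink_absorbing : M.IsAbsorbing z
  reach : ∀ σ : M.Strategy, M.reachProb σ (Φ.target ∪ {z}) = 1

/-! ### Multi-objective reachability queries -/

/-- The achievable points of the query with target sets `T 1, …, T n`. -/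
def achievable (M : MDP S A) {n : ℕ} (T : Fin n → Set S) : Set (Fin n → ℝ) :=
  {p | ∃ σ : M.Strategy, ∀ i, p i ≤ M.reachProb σ (T i)}

/-- The Pareto frontier of the query: the achievable points that are maximal in the pointwise
order. -/
def paretoFrontier (M : MDP S A) {n : ℕ} (T : Fin n → Set S) : Set (Fin n → ℝ) :=
  {u | u ∈ M.achievable T ∧ ¬ ∃ v ∈ M.achievable T, u ≠ v ∧ u ≤ v}

end MDP

/-- The obtainset of an outcome in a stopping MDP with sink `z`: the targets with reward `o` if
`o ≠ 0`, and `{z}` if `o = 0`. -/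
def WRObjective.obtainset {S : Type*} (Φ : WRObjective S) (z : S) (o : ℚ) : Set S :=
  open Classical in if o = 0 then {z} else Φ.rewardSet o

/-- The multi-objective query of `Φ`: its target sets are the obtainsets of the outcomes. -/
def WRObjective.query {S : Type*} (Φ : WRObjective S) (z : S) {k : ℕ} (o : Fin k → ℚ) :
    Fin k → Set S :=
  fun i => Φ.obtainset z (o i)

end

/-! In a stopping MDP almost every path ends up in a target or the sink, and there it freezes, since
these states are absorbing. Hence a target-free BSCC is reached exactly when `z` is, up to a null
set (`reachProb_chainObtainset`), so the prospect of `M^σ` is the vector of query probabilities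
under `σ`. Moreover, each run obtains exactly one outcome almost surely, so these probabilities sum
to one (`sum_reachProb_query`). Vectors of equal sum cannot strictly dominate each other; thus every
realized vector is Pareto optimal, and every Pareto point is realized
(`mem_paretoFrontier_iff_of_sum_eq`). -/

open Relation

/-! ### Almost sure behaviour of the paths of a countable Markov chain -/

namespace MarkovChain

variable {Q : Type*} (C : MarkovChain Q)

theorem exists_step (q : Q) : ∃ q', C.Step q q' := (C.trans q).support_nonempty

variable {C} in
theorem reflTransGen_of_forall_step {ω : ℕ → Q} (h : ∀ n, C.Step (ω n) (ω (n + 1))) {i j : ℕ}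
    (hij : i ≤ j) : ReflTransGen C.Step (ω i) (ω j) := by
  induction j, hij using Nat.le_induction with
  | base => exact .refl
  | succ k _ ih => exact ih.tail (h k)

variable {C} in
theorem transGen_of_forall_step {ω : ℕ → Q} (h : ∀ n, C.Step (ω n) (ω (n + 1))) {i j : ℕ}
    (hij : i < j) : TransGen C.Step (ω i) (ω j) :=
  .head' (h i) (reflTransGen_of_forall_step h hij)

variable [MeasurableSpace Q] [DiscreteMeasurableSpace Q]

instance : IsProbabilityMeasure C.pathMeasure := by
  unfold pathMeasure
  infer_instance

theorem measurableSet_reach (T : Set Q) : MeasurableSet {ω : ℕ → Q | ∃ j, ω j ∈ T} :=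
  measurableSet_setOfPred.2 <| Measurable.exists fun j =>
    measurableSet_setOfPred.1 ((measurable_pi_apply j) (MeasurableSet.of_discrete (s := T)))

variable [Countable Q]

/-- Almost every path follows the transitions of positive probability. -/
theorem ae_forall_step : ∀ᵐ ω ∂C.pathMeasure, ∀ n, C.Step (ω n) (ω (n + 1)) := by
  refine ae_all_iff.2 fun n => ?_
  have hm : Measurable fun ω : ℕ → Q => (Preorder.frestrictLe (π := fun _ => Q) n ω, ω (n + 1)) :=
    by fun_prop
  -- Countability of `Q` enters here: it makes every subset of `Q × Q` measurable.
  have hs : MeasurableSet {x : ((_ : Finset.Iic n) → Q) × Q |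
      C.Step (x.1 ⟨n, Finset.mem_Iic.2 le_rfl⟩) x.2} :=
    (show Measurable fun x : ((_ : Finset.Iic n) → Q) × Q =>
      (x.1 ⟨n, Finset.mem_Iic.2 le_rfl⟩, x.2) by fun_prop)
      (MeasurableSet.of_discrete (s := {y : Q × Q | C.Step y.1 y.2}))
  have key : ∀ᵐ x ∂(C.pathMeasure.map
      fun ω : ℕ → Q => (Preorder.frestrictLe (π := fun _ => Q) n ω, ω (n + 1))),
      C.Step (x.1 ⟨n, Finset.mem_Iic.2 le_rfl⟩) x.2 := by
    unfold pathMeasure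
    -- The joint law of history and next state is the law of the history composed with the step
    -- kernel, so it suffices that each `PMF` gives no mass to the complement of its support.
    rw [← Kernel.map_frestrictLe_trajMeasure_compProd_eq_map_trajMeasure,
      Measure.ae_compProd_iff hs]
    refine .of_forall fun x => ?_
    rw [ae_iff]
    exact (PMF.toMeasure_apply_eq_zero_iff _ MeasurableSet.of_discrete).2
      (Set.disjoint_left.2 fun q hq hq' => hq' hq)
  exact ae_of_ae_map hm.aemeasurable key

end MarkovChain

/-! ### Absorbing states and outcomes in the induced chain -/

namespace MDP

variable {S A : Type*} {M : MDP S A}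

instance [Countable S] [Countable A] : Countable M.FPath :=
  inferInstanceAs (Countable {h : List (A × S) // M.IsPath h})

theorem step_induced_iff {σ : M.Strategy} {q q' : M.FPath} :
    (M.induced σ).Step q q' ↔
      ∃ a ∈ (σ q).support, ∃ s, ∃ hs : s ∈ (M.trans q.last a).support, q' = q.extend a s hs := by
  simp only [MarkovChain.Step, induced, PMF.mem_support_bind_iff, PMF.mem_support_bindOnSupport_iff,
    PMF.mem_support_pure_iff]

theorem last_eq_of_step {σ : M.Strategy} {q q' : M.FPath} (hq : M.IsAbsorbing q.last)
    (h : (M.induced σ).Step q q') : q'.last = q.last := by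
  obtain ⟨a, -, s, hs, rfl⟩ := step_induced_iff.1 h
  have hs' := hs
  rw [hq a, PMF.mem_support_pure_iff] at hs'
  exact hs'

theorem last_eq_of_reflTransGen {σ : M.Strategy} {q q' : M.FPath} (hq : M.IsAbsorbing q.last)
    (h : ReflTransGen (M.induced σ).Step q q') : q'.last = q.last := by
  induction h with
  | refl => rfl
  | tail _ hs ih => rw [← ih] at hq ⊢; exact last_eq_of_step hq hs

/-- A path of the induced chain that ends in an absorbing state lies in the bottom component of
that state. -/
theorem inBSCC_of_isAbsorbing (σ : M.Strategy) {q : M.FPath} (hq : M.IsAbsorbing q.last) :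
    (M.induced σ).InBSCC FPath.last q {q.last} := by
  refine ⟨rfl, fun q' hq' => Set.eq_singleton_iff_unique_mem.2 ⟨?_, ?_⟩⟩
  -- The label must be seen after at least one step, so a successor is needed; the support of a
  -- `PMF` is non-empty.
  · obtain ⟨r, hr⟩ := (M.induced σ).exists_step q'
    exact ⟨r, .single hr, last_eq_of_reflTransGen hq (hq'.tail hr)⟩
  · rintro s ⟨r, hr, rfl⟩
    exact last_eq_of_reflTransGen hq (hq'.trans hr.to_reflTransGen)

theorem ae_reach {σ : M.Strategy} {T : Set S} (h : M.reachProb σ T = 1) :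
    ∀ᵐ ω ∂(M.induced σ).pathMeasure, ∃ j, (ω j).last ∈ T := by
  rw [reachProb, MarkovChain.reachProb, Measure.real, ENNReal.toReal_eq_one_iff,
    ← mem_ae_iff_prob_eq_one (MarkovChain.measurableSet_reach _)] at h
  exact h

/-- In a stopping MDP the outcome `0` is obtained by reaching the sink. -/
theorem reachProb_chainObtainset [Finite S] [Finite A] {Φ : WRObjective S} {z : S}
    (h_absorbing : ∀ s ∈ Φ.target, M.IsAbsorbing s) (h_stopping : M.IsStopping Φ z)
    (σ : M.Strategy) (o : ℚ) :
    (M.induced σ).reachProb (Φ.chainObtainset (M.induced σ) FPath.last o) =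
      M.reachProb σ (Φ.obtainset z o) := by
  by_cases ho : o = 0
  swap
  · simp only [reachProb, WRObjective.chainObtainset, WRObjective.obtainset, ho, if_false]
  simp only [reachProb, WRObjective.chainObtainset, WRObjective.obtainset, ho, if_true]
  refine measureReal_congr ?_
  filter_upwards [(M.induced σ).ae_forall_step, ae_reach (h_stopping.reach σ)] with ω hω hreach
  refine propext ⟨?_, ?_⟩
  · rintro ⟨j, B, hB, hBF⟩
    obtain ⟨m, hm⟩ := hreach
    have hdisj : ∀ s ∈ B, s ∉ Φ.target := fun s hs hs' =>
      Set.eq_empty_iff_forall_notMem.1 hBF s ⟨hs, hs'⟩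
    have habs : M.IsAbsorbing (ω m).last := by
      rcases hm with hm | hm
      · exact h_absorbing _ hm
      · exact hm ▸ h_stopping.sink_absorbing
    -- If the absorbing state is hit no later than time `j`, its label persists until `j`; otherwise
    -- it is a label seen strictly after entering the component.
    have hmB : (ω m).last ∈ B := by
      rcases le_or_gt m j with hmj | hjm
      · rw [← last_eq_of_reflTransGen habs (MarkovChain.reflTransGen_of_forall_step hω hmj)]
        exact hB.1
      · rw [← hB.2 _ .refl]
        exact ⟨_, MarkovChain.transGen_of_forall_step hω hjm, rfl⟩
    exact ⟨m, hm.resolve_left (hdisj _ hmB)⟩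
  · rintro ⟨j, hj : (ω j).last = z⟩
    refine ⟨j, {(ω j).last}, inBSCC_of_isAbsorbing σ (hj ▸ h_stopping.sink_absorbing), ?_⟩
    rw [hj, Set.singleton_inter_eq_empty]
    exact h_stopping.sink_notMem

/-- The obtainsets of the distinct outcomes partition the targets and the sink, so that their
reachability probabilities sum up to one. -/
theorem sum_reachProb_query [Finite S] [Finite A] {Φ : WRObjective S} {z : S}
    (h_absorbing : ∀ s ∈ Φ.target, M.IsAbsorbing s) (h_reward : ∀ s, Φ.reward s ≠ 0)
    (h_stopping : M.IsStopping Φ z) {k : ℕ} {o : Fin k → ℚ} (ho_inj : Function.Injective o)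
    (ho_range : Set.range o = Φ.outc) (σ : M.Strategy) :
    ∑ i, M.reachProb σ (Φ.query z o i) = 1 := by
  have hT : ∀ i, ∀ s ∈ Φ.query z o i, M.IsAbsorbing s ∧ ∀ i', s ∈ Φ.query z o i' → i = i' := by
    intro i s hs
    simp only [WRObjective.query, WRObjective.obtainset] at hs ⊢
    split_ifs at hs with h0
    · obtain rfl : s = z := hs
      refine ⟨h_stopping.sink_absorbing, fun i' hi' => ho_inj ?_⟩
      split_ifs at hi' with h1
      · rw [h0, h1]
      · exact absurd hi'.1 h_stopping.sink_notMem
    · obtain ⟨hF, hr⟩ := hs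
      refine ⟨h_absorbing _ hF, fun i' hi' => ho_inj ?_⟩
      split_ifs at hi' with h1
      · exact absurd ((hi' : s = z) ▸ hF) h_stopping.sink_notMem
      · rw [← hr, hi'.2]
  have hcover : ∀ s ∈ Φ.target ∪ {z}, ∃ i, s ∈ Φ.query z o i := by
    rintro s (hs | rfl)
    · obtain ⟨i, hi⟩ : Φ.reward ⟨s, hs⟩ ∈ Set.range o := ho_range ▸ Or.inl ⟨_, rfl⟩
      refine ⟨i, ?_⟩
      -- A target of reward `0` would be covered by no obtainset, since that of `0` is just `{z}`.
      simp only [WRObjective.query, WRObjective.obtainset, hi, h_reward, if_false]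
      exact ⟨hs, rfl⟩
    · obtain ⟨i, hi⟩ : (0 : ℚ) ∈ Set.range o := ho_range ▸ Or.inr rfl
      refine ⟨i, ?_⟩
      simp only [WRObjective.query, WRObjective.obtainset, hi, if_true, Set.mem_singleton_iff]
  set E : Fin k → Set (ℕ → M.FPath) := fun i => {ω | ∃ j, (ω j).last ∈ Φ.query z o i} with hE
  have hEm : ∀ i, MeasurableSet (E i) := fun i =>
    MarkovChain.measurableSet_reach {h : M.FPath | h.last ∈ Φ.query z o i}
  -- Only almost everywhere: a sequence in `ℕ → M.FPath` that ignores the transitions may visit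
  -- several obtainsets. Along a genuine path the earlier visit freezes the last state, which lies
  -- in one obtainset only.
  have hdisj : Pairwise (Function.onFun (AEDisjoint (M.induced σ).pathMeasure) E) := by
    intro i i' hne
    refine measure_mono_null (t := {ω | ¬ ∀ n, (M.induced σ).Step (ω n) (ω (n + 1))}) ?_
      (ae_iff.1 (M.induced σ).ae_forall_step)
    rintro ω ⟨⟨j, hj⟩, j', hj'⟩ hω
    rcases le_total j j' with h | h
    · have := last_eq_of_reflTransGen (hT i _ hj).1 (MarkovChain.reflTransGen_of_forall_step hω h)
      exact hne ((hT i _ hj).2 i' (this ▸ hj'))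
    · have := last_eq_of_reflTransGen (hT i' _ hj').1 (MarkovChain.reflTransGen_of_forall_step hω h)
      exact hne ((hT i' _ hj').2 i (this ▸ hj)).symm
  have hone : (M.induced σ).pathMeasure (⋃ i, E i) = 1 := by
    rw [← mem_ae_iff_prob_eq_one (.iUnion hEm)]
    filter_upwards [ae_reach (h_stopping.reach σ)] with ω ⟨j, hj⟩
    obtain ⟨i, hi⟩ := hcover _ hj
    exact Set.mem_iUnion.2 ⟨i, j, hi⟩
  rw [measure_iUnion₀ hdisj fun i => (hEm i).nullMeasurableSet, tsum_fintype] at hone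
  change ∑ i, ((M.induced σ).pathMeasure (E i)).toReal = 1
  rw [← ENNReal.toReal_sum fun i _ => measure_ne_top _ _, hone, ENNReal.toReal_one]

/-- If the reachability probabilities of a query have a constant sum, then its Pareto frontier
consists of the points realized exactly. -/
theorem mem_paretoFrontier_iff_of_sum_eq {n : ℕ} {T : Fin n → Set S} {c : ℝ}
    (h : ∀ σ : M.Strategy, ∑ i, M.reachProb σ (T i) = c) {p : Fin n → ℝ} :
    p ∈ M.paretoFrontier T ↔ ∃ σ : M.Strategy, (fun i => M.reachProb σ (T i)) = p := by
  constructor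
  · rintro ⟨⟨σ, hσ⟩, hmax⟩
    refine ⟨σ, ?_⟩
    by_contra hne
    -- The vector realized by `σ` is itself achievable and dominates `p`.
    exact hmax ⟨_, ⟨σ, fun i => le_rfl⟩, Ne.symm hne, hσ⟩
  · rintro ⟨σ, rfl⟩
    refine ⟨⟨σ, fun i => le_rfl⟩, ?_⟩
    rintro ⟨v, ⟨τ, hτ⟩, hne, hle⟩
    -- `v` is squeezed between the vectors realized by `σ` and `τ`, both of sum `c`; with the
    -- pointwise inequality, equal sums force equal entries.
    have hsum : ∑ i, M.reachProb σ (T i) = ∑ i, v i :=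
      le_antisymm (Finset.sum_le_sum fun i _ => hle i)
        ((Finset.sum_le_sum fun i _ => hτ i).trans_eq ((h τ).trans (h σ).symm))
    exact hne (funext fun i =>
      (Finset.sum_eq_sum_iff_of_le fun i _ => hle i).1 hsum i (Finset.mem_univ i))

end MDP

theorem mainTheorem8 {S A : Type*} [Finite S] [Finite A] (M : MDP S A) (Φ : WRObjective S)
    (z : S) (h_absorbing : ∀ s ∈ Φ.target, M.IsAbsorbing s) (h_reward : ∀ s, Φ.reward s ≠ 0)
    (h_stopping : M.IsStopping Φ z)
    {k : ℕ} (o : Fin k → ℚ) (ho_mono : StrictMono o) (ho_range : Set.range o = Φ.outc) :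
    {x | ∃ σ : M.Strategy, Φ.prospect o (M.induced σ) MDP.FPath.last = x} =
      {x | ∃ p ∈ M.paretoFrontier (Φ.query z o), x = (o, p)} := by
  have hpros : ∀ σ : M.Strategy, Φ.prospect o (M.induced σ) MDP.FPath.last =
      (o, fun i => M.reachProb σ (Φ.query z o i)) := fun σ => by
    simp only [WRObjective.prospect, WRObjective.query,
      MDP.reachProb_chainObtainset h_absorbing h_stopping]
  ext x
  simp only [Set.mem_ofPred_eq, hpros, MDP.mem_paretoFrontier_iff_of_sum_eq
    (MDP.sum_reachProb_query h_absorbing h_reward h_stopping ho_mono.injective ho_range)]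
  constructor
  · rintro ⟨σ, rfl⟩
    exact ⟨_, ⟨σ, rfl⟩, rfl⟩
  · rintro ⟨_, ⟨σ, rfl⟩, rfl⟩
    exact ⟨σ, rfl⟩
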